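/- Let $-\infty<a<b<\infty$, $d\ge 1$, $\alpha\in(0,1]$, $K,L\in(0,\infty)$, $H\in\mathbb{R}$, and let $R<\infty$ satisfy $$R\ \ge\ e^{K(b-a)}(1+K)\max\{e^{K(b-a)}+K(b-a),\,2\}.$$ (This includes $R=R_2:=\max\{R_1,K_2(1+K)\}$ with $R_1=e^{K(b-a)}(1+K)(e^{K(b-a)}+K(b-a))$, $K_2=2e^{(K+1)(b-a)}$, and the value $R_2:=e^{K(b-a)}(1+K)\max\{e^{K(b-a)}+K(b-a),2\}$.) Let $\|\cdot\|$ be the Euclidean norm on $\mathbb{R}^d$. Let $F=F_R^{\alpha,1}$ be the class of all pairs $(\xi,g)$ with $\xi\in\mathbb{R}^d$, $\|\xi\|\le K$, and $g:[a,b]\times\mathbb{R}^d\to\mathbb{R}^d$ continuous such that * $\|g(t,y)\|\le K(1+\|y\|)$ for all $(t,y)\in[a,b]\times\mathbb{R}^d$; * $\langle y_1-y_2,\,g(t,y_1)-g(t,y_2)\rangle\le H\|y_1-y_2\|^2$ for all $t\in[a,b]$, $\|y_1\|,\|y_2\|\le R$; * $\|g(t_1,y_1)-g(t_2,y_2)\|\le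 L(|t_1-t_2|^{\alpha}+\|y_1-y_2\|)$ for all $t_1,t_2\in[a,b]$, $\|y_1\|,\|y_2\|\le R$. Assume $H\ge -L$ and $HR>-K(1+R)$ (both hold if $H\ge 0$). (If one of them fails, then $F$ is empty or all $g$ occurring in $F$ coincide on $[a,b]\times\{\|y\|\le R\}$.) For $\delta\ge 0$ let $V_{(\xi,g)}(\delta)$ be the set of all $(\tilde\xi,\tilde g)$ with $\|\tilde\xi-\xi\|\le\delta$ and $\tilde g=g+\eta$, where $\eta:[a,b]\times\mathbb{R}^d\to\mathbb{R}^d$ is Borel measurable and $\|\eta(t,y)\|\le\delta(1+\|y\|)$ for all $(t,y)$. Let $\Phi_n$ be the set of all algorithms $\mathcal{A}(\tilde\xi,\tilde g)=\varphi(\tilde g(t_0,y_0),\dots,\tilde g(t_{i-1},y_{i-1}),\tilde\xi)$ with $i\le n$ evaluations, where $(t_0,y_0)=\psi_0(\tilde\xi)$, $(t_j,y_j)=\psi_j(\tilde g(t_0,y_0),\dots,\tilde g(t_{j-1},y_{j-1}),\tilde\xi)\in[a,b]\times\mathbb{R}^d$, the $\psi_j$ are arbitrary functions, and $\varphi$ is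 an arbitrary function with values in the bounded functions $[a,b]\to\mathbb{R}^d$. Then for every $(\xi,g)\in F$ the problem $z'(t)=g(t,z(t))$, $t\in[a,b]$, $z(a)=\xi$ has a unique solution $z(\xi,g)$. Put $$e(\mathcal{A},F,\delta)=\sup_{(\xi,g)\in F}\ \sup_{(\tilde\xi,\tilde g)\in V_{(\xi,g)}(\delta)}\ \sup_{a\le t\le b}\|z(\xi,g)(t)-\mathcal{A}(\tilde\xi,\tilde g)(t)\|,\qquad e_n(F,\delta)=\inf_{\mathcal{A}\in\Phi_n}e(\mathcal{A},F,\delta).$$ Then $e_n(F,\delta)=\Theta(n^{-\alpha}+\delta)$ as $n\to\infty$, $\delta\to0^+$: there are $c,C>0$, $n_0\in\mathbb{N}$ and $\delta_0>0$, depending only on $a,b,d,\alpha,K,H,L,R$, such that $$c\,(n^{-\alpha}+\delta)\ \le\ e_n(F,\delta)\ \le\ C\,(n^{-\alpha}+\delta)\qquad\text{for all } n\ge n_0,\ 0\le\delta\le\delta_0 .$$ The Euler method attains this order. Let $h=(b-a)/n$, $t_k=a+kh$, $\tilde y_0=\tilde\xi$, $\tilde y_{k+1}=\tilde y_k+h\,\tilde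 g(t_k,\tilde y_k)$ and $\tilde l_n(t)=\tilde y_k+(t-t_k)\tilde g(t_k,\tilde y_k)$ for $t\in[t_k,t_{k+1}]$, $0\le k\le n-1$. Then $\tilde l_n\in\Phi_n$ for all $n\ge 1$, and $e(\tilde l_n,F,\delta)\le C(n^{-\alpha}+\delta)$ for all $n\ge n_0$, $0\le\delta\le\delta_0$. -/

import Mathlib

noncomputable section

namespace NoisyODE

open scoped ENNReal

/-- The space `ℝᵈ` with the Euclidean norm. -/
abbrev Vec (d : ℕ) : Type := EuclideanSpace ℝ (Fin d)

/-- Functions `[a,b] × ℝᵈ → ℝᵈ`. -/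
abbrev RHS (a b : ℝ) (d : ℕ) : Type := Set.Icc a b × Vec d → Vec d

/-- `z : [a,b] → ℝᵈ` solves `z'(t) = g(t, z(t))` on `[a,b]`, `z(a) = ξ` (one-sided derivatives at
the end points). The derivative is that of some function on `ℝ` that extends `z`. -/
def IsSolution {a b : ℝ} {d : ℕ} (ξ : Vec d) (g : RHS a b d) (z : Set.Icc a b → Vec d) : Prop :=
  ∃ Z : ℝ → Vec d, (∀ t : Set.Icc a b, Z t = z t) ∧ Z a = ξ ∧
    ∀ t : Set.Icc a b, HasDerivWithinAt Z (g (t, z t)) (Set.Icc a b) t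

open Classical in
/-- The solution `z(ξ,g)` of the initial value problem
(the zero function if there is no solution). -/
def solution {a b : ℝ} {d : ℕ} (ξ : Vec d) (g : RHS a b d) : Set.Icc a b → Vec d :=
  if h : ∃ z, IsSolution ξ g z then Classical.choose h else 0

/-- The class `F_R^{α,β}(a,b,d,K,H,L)` of pairs `(ξ, g)`. -/
structure InClass (a b : ℝ) (d : ℕ) (α β K H L R : ℝ) (ξ : Vec d) (g : RHS a b d) : Prop where
  norm_init_le : ‖ξ‖ ≤ K
  continuous : Continuous g
  linear_growth : ∀ (t : Set.Icc a b) (y : Vec d), ‖g (t, y)‖ ≤ K * (1 + ‖y‖)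
  one_sided : ∀ (t : Set.Icc a b) (y₁ y₂ : Vec d), ‖y₁‖ ≤ R → ‖y₂‖ ≤ R →
    inner ℝ (y₁ - y₂) (g (t, y₁) - g (t, y₂)) ≤ H * ‖y₁ - y₂‖ ^ 2
  holder : ∀ (t₁ t₂ : Set.Icc a b) (y₁ y₂ : Vec d), ‖y₁‖ ≤ R → ‖y₂‖ ≤ R →
    ‖g (t₁, y₁) - g (t₂, y₂)‖ ≤ L * (|(t₁ : ℝ) - t₂| ^ α + ‖y₁ - y₂‖ ^ β)

/-- `F_R^{α,β}(a,b,d,K,H,L)` as a set. -/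
def problemClass (a b : ℝ) (d : ℕ) (α β K H L R : ℝ) : Set (Vec d × RHS a b d) :=
  {p | InClass a b d α β K H L R p.1 p.2}

/-- The set `𝒦(δ)` of corrupting functions. -/
def corruptions (a b : ℝ) (d : ℕ) (δ : ℝ) : Set (RHS a b d) :=
  {η | Measurable η ∧ ∀ (t : Set.Icc a b) (y : Vec d), ‖η (t, y)‖ ≤ δ * (1 + ‖y‖)}

/-- The set `V_{(ξ,g)}(δ)` of noisy versions `(ξ̃, g̃)` of `(ξ, g)`. -/
def noisyData {a b : ℝ} {d : ℕ} (ξ : Vec d) (g : RHS a b d) (δ : ℝ) : Set (Vec d × RHS a b d) :=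
  {q | ‖q.1 - ξ‖ ≤ δ ∧ ∃ η ∈ corruptions a b d δ, q.2 = g + η}

/-- A map that sends data `(ξ̃, g̃)` to an approximation `[a,b] → ℝᵈ` of the solution. -/
abbrev Method (a b : ℝ) (d : ℕ) : Type := Vec d → RHS a b d → Set.Icc a b → Vec d

/-- An adaptive algorithm that makes `card` evaluations. `point j` is `ψ_j`: it chooses the
evaluation point number `j` from the `j` values observed so far and `ξ̃`. `out` is `φ`: it maps the
observed values and `ξ̃` to a bounded function on `[a,b]`. -/
structure Algorithm (a b : ℝ) (d : ℕ) where
  card : ℕ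
  point : (j : ℕ) → (Fin j → Vec d) → Vec d → Set.Icc a b × Vec d
  out : (Fin card → Vec d) → Vec d → Set.Icc a b → Vec d
  out_bounded : ∀ v x, ∃ M : ℝ, ∀ t, ‖out v x t‖ ≤ M

/-- The first `j` values of `g` observed by the algorithm `A` started with initial value `x`. -/
def Algorithm.observed {a b : ℝ} {d : ℕ} (A : Algorithm a b d) (x : Vec d) (g : RHS a b d) :
    (j : ℕ) → Fin j → Vec d
  | 0 => Fin.elim0
  | j + 1 => Fin.snoc (α := fun _ => Vec d) (A.observed x g j)
      (g (A.point j (A.observed x g j) x))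

/-- The output of the algorithm on the data `(x, g)`. -/
def Algorithm.run {a b : ℝ} {d : ℕ} (A : Algorithm a b d) : Method a b d :=
  fun x g => A.out (A.observed x g A.card) x

/-- `Φ_n`: the methods that are given by algorithms with at most `n` evaluations. -/
def methods (a b : ℝ) (d n : ℕ) : Set (Method a b d) :=
  {M | ∃ A : Algorithm a b d, A.card ≤ n ∧ A.run = M}

/-- `e(M, ξ, g, δ)`. -/
def error {a b : ℝ} {d : ℕ} (M : Method a b d) (ξ : Vec d) (g : RHS a b d) (δ : ℝ) : ℝ≥0∞ :=
  ⨆ q ∈ noisyData ξ g δ, ⨆ t : Set.Icc a b, ‖solution ξ g t - M q.1 q.2 t‖ₑ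

/-- The worst-case error `e(M, 𝒢, δ)` over a set `𝒢` of problems. -/
def worstCaseError {a b : ℝ} {d : ℕ} (M : Method a b d) (G : Set (Vec d × RHS a b d)) (δ : ℝ) :
    ℝ≥0∞ :=
  ⨆ p ∈ G, error M p.1 p.2 δ

/-- The `n`-th minimal error `e_n(𝒢, δ)`. -/
def minimalError {a b : ℝ} {d : ℕ} (n : ℕ) (G : Set (Vec d × RHS a b d)) (δ : ℝ) : ℝ≥0∞ :=
  ⨅ M ∈ methods a b d n, worstCaseError M G δ

/-- The grid point `t_k = a + k h`, `h = (b - a) / n`, as an element of `[a,b]`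
(the projection onto `[a,b]` changes nothing for `k ≤ n`). -/
def gridPoint {a b : ℝ} (hab : a ≤ b) (n k : ℕ) : Set.Icc a b :=
  Set.projIcc a b hab (a + k * ((b - a) / n))

/-- The Euler iterates `y_0 = x`, `y_{k+1} = y_k + h g(t_k, y_k)`. -/
def eulerIterate {a b : ℝ} (hab : a ≤ b) {d : ℕ} (n : ℕ) (x : Vec d) (g : RHS a b d) : ℕ → Vec d
  | 0 => x
  | k + 1 => eulerIterate hab n x g k +
      ((b - a) / n) • g (gridPoint hab n k, eulerIterate hab n x g k)

/-- An index `k ≤ n - 1` with `t ∈ [t_k, t_{k+1}]`, for `t ∈ [a,b]` and `n ≥ 1`. -/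
def cellIndex (a b : ℝ) (n : ℕ) (t : ℝ) : ℕ :=
  min ⌊(t - a) / ((b - a) / n)⌋₊ (n - 1)

/-- The Euler method with `n` steps: the piecewise linear function
`t ↦ y_k + (t - t_k) g(t_k, y_k)` for `t ∈ [t_k, t_{k+1}]`. -/
def euler {a b : ℝ} (hab : a ≤ b) (d n : ℕ) : Method a b d := fun x g t =>
  let k := cellIndex a b n t
  eulerIterate hab n x g k +
    ((t : ℝ) - gridPoint hab n k) • g (gridPoint hab n k, eulerIterate hab n x g k)

/-- The radius `e^{K(b-a)} (1 + K) max {e^{K(b-a)} + K(b-a), 2}`. -/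
def radius (a b K : ℝ) : ℝ :=
  Real.exp (K * (b - a)) * (1 + K) * max (Real.exp (K * (b - a)) + K * (b - a)) 2

end NoisyODE

end

open NoisyODE

namespace NoisyODE

variable {a b : ℝ} {d : ℕ}

/-! ### Radial retraction, the radius, and a priori bounds. -/

/-- The radial retraction of `ℝᵈ` onto the closed ball of radius `R` around `0`. -/
noncomputable def radialProj {d : ℕ} (R : ℝ) (y : Vec d) : Vec d := (R / max R ‖y‖) • y

theorem radialProj_of_norm_le {R : ℝ} (hR : 0 < R) {y : Vec d} (hy : ‖y‖ ≤ R) :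
    radialProj R y = y := by
  simp [radialProj, max_eq_left hy, div_self hR.ne']

theorem norm_radialProj_le_radius {R : ℝ} (hR : 0 < R) (y : Vec d) : ‖radialProj R y‖ ≤ R := by
  have hm : 0 < max R ‖y‖ := lt_max_of_lt_left hR
  rw [radialProj, norm_smul, Real.norm_of_nonneg (by positivity), div_mul_eq_mul_div,
    div_le_iff₀ hm]
  gcongr
  exact le_max_right _ _

theorem norm_radialProj_le_norm {R : ℝ} (hR : 0 < R) (y : Vec d) : ‖radialProj R y‖ ≤ ‖y‖ := by
  have hm : 0 < max R ‖y‖ := lt_max_of_lt_left hR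
  rw [radialProj, norm_smul, Real.norm_of_nonneg (by positivity)]
  exact mul_le_of_le_one_left (norm_nonneg _) ((div_le_one hm).2 (le_max_left _ _))

/-- Rescaling `x - y` and changing the scaling factor on `y` each cost at most `‖x - y‖`. The
constant is not sharp, but any Lipschitz constant serves. -/
theorem norm_radialProj_sub_le {R : ℝ} (hR : 0 < R) (x y : Vec d) :
    ‖radialProj R x - radialProj R y‖ ≤ 2 * ‖x - y‖ := by
  have hp : 0 < max R ‖x‖ := lt_max_of_lt_left hR
  have hq : 0 < max R ‖y‖ := lt_max_of_lt_left hR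
  have hpq : |max R ‖y‖ - max R ‖x‖| ≤ ‖x - y‖ := by
    calc |max R ‖y‖ - max R ‖x‖| ≤ |‖y‖ - ‖x‖| := by
          simpa using abs_max_sub_max_le_max R ‖y‖ R ‖x‖
      _ ≤ ‖y - x‖ := abs_norm_sub_norm_le _ _
      _ = ‖x - y‖ := norm_sub_rev _ _
  have key : radialProj R x - radialProj R y =
      (R / max R ‖x‖) • (x - y) + (R / max R ‖x‖ - R / max R ‖y‖) • y := by
    simp only [radialProj]
    module
  have h1 : ‖(R / max R ‖x‖) • (x - y)‖ ≤ ‖x - y‖ := by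
    rw [norm_smul, Real.norm_of_nonneg (by positivity)]
    exact mul_le_of_le_one_left (norm_nonneg _) ((div_le_one hp).2 (le_max_left _ _))
  have h2 : ‖(R / max R ‖x‖ - R / max R ‖y‖) • y‖ ≤ ‖x - y‖ := by
    have e : R / max R ‖x‖ - R / max R ‖y‖ =
        (max R ‖y‖ - max R ‖x‖) * (R / (max R ‖x‖ * max R ‖y‖)) := by
      field_simp
    have e' : R / (max R ‖x‖ * max R ‖y‖) * ‖y‖ ≤ 1 := by
      rw [div_mul_eq_mul_div, div_le_one (by positivity)]
      exact mul_le_mul (le_max_left _ _) (le_max_right _ _) (norm_nonneg _) hp.le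
    rw [e, norm_smul, norm_mul, Real.norm_of_nonneg (r := R / _) (by positivity), mul_assoc,
      Real.norm_eq_abs]
    calc _ ≤ ‖x - y‖ * 1 := by gcongr
      _ = _ := mul_one _
  rw [key]
  linarith [norm_add_le ((R / max R ‖x‖) • (x - y)) ((R / max R ‖x‖ - R / max R ‖y‖) • y)]

theorem continuous_radialProj {R : ℝ} (hR : 0 < R) :
    Continuous (radialProj R : Vec d → Vec d) :=
  (LipschitzWith.of_dist_le_mul (K := 2) fun x y => by
    simpa [dist_eq_norm] using norm_radialProj_sub_le hR x y).continuous

theorem two_mul_exp_le_radius {K : ℝ} (hK : 0 ≤ K) :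
    2 * (Real.exp (K * (b - a)) * (1 + K)) ≤ radius a b K := by
  rw [radius, mul_comm 2]
  gcongr
  exact le_max_right _ _

theorem exp_le_radius {K : ℝ} (hK : 0 ≤ K) :
    Real.exp (K * (b - a)) * (1 + K) ≤ radius a b K := by
  have := two_mul_exp_le_radius (a := a) (b := b) hK
  have : 0 < Real.exp (K * (b - a)) * (1 + K) := by positivity
  linarith

theorem add_one_le_radius (hab : a ≤ b) {K : ℝ} (hK : 0 ≤ K) : K + 1 ≤ radius a b K := by
  refine le_trans ?_ (exp_le_radius hK)
  have : 1 ≤ Real.exp (K * (b - a)) := Real.one_le_exp (mul_nonneg hK (sub_nonneg.2 hab))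
  nlinarith

theorem hasDerivWithinAt_Ici_of_Icc {E : Type*} [NormedAddCommGroup E] [NormedSpace ℝ E]
    {f : ℝ → E} {f' : E} {u v t : ℝ} (h : HasDerivWithinAt f f' (Set.Icc u v) t)
    (ht : t ∈ Set.Ico u v) : HasDerivWithinAt f f' (Set.Ici t) t :=
  h.mono_of_mem_nhdsWithin (Icc_mem_nhdsGE_of_mem ht)

/-- Gronwall's bound for the trajectories of a vector field of linear growth. -/
theorem norm_le_of_linear_growth {K : ℝ} (hK : 0 < K) {Z Z' : ℝ → Vec d}
    (hZ : ∀ t ∈ Set.Icc a b, HasDerivWithinAt Z (Z' t) (Set.Icc a b) t) (h0 : ‖Z a‖ ≤ K)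
    (hg : ∀ t ∈ Set.Icc a b, ‖Z' t‖ ≤ K * (1 + ‖Z t‖)) {t : ℝ} (ht : t ∈ Set.Icc a b) :
    ‖Z t‖ ≤ Real.exp (K * (b - a)) * (1 + K) := by
  have := norm_le_gronwallBound_of_norm_deriv_right_le (f := Z) (f' := Z') (δ := K) (K := K)
    (ε := K) (a := a) (b := b) (fun t ht => (hZ t ht).continuousWithinAt)
    (fun t ht => hasDerivWithinAt_Ici_of_Icc (hZ t ⟨ht.1, ht.2.le⟩) ht) h0
    (fun t ht => by linarith [hg t ⟨ht.1, ht.2.le⟩]) t ht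
  -- With initial bound, rate and inhomogeneity all `K`, Gronwall gives `(1 + K) e^{K(t-a)} - 1`.
  rw [gronwallBound_of_K_ne_0 hK.ne'] at this
  simp only [div_self hK.ne'] at this
  have h2 : Real.exp (K * (t - a)) ≤ Real.exp (K * (b - a)) := by
    gcongr
    exact ht.2
  nlinarith

/-! ### Existence and uniqueness of the solution. -/

section Solution

variable {α β K H L R : ℝ} {ξ : Vec d} {g : RHS a b d}

theorem InClass.norm_sub_le (hg : InClass a b d α 1 K H L R ξ g) (hα : 0 < α) (t : Set.Icc a b)
    {y₁ y₂ : Vec d} (h₁ : ‖y₁‖ ≤ R) (h₂ : ‖y₂‖ ≤ R) :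
    ‖g (t, y₁) - g (t, y₂)‖ ≤ L * ‖y₁ - y₂‖ := by
  simpa [Real.zero_rpow hα.ne'] using hg.holder t t y₁ y₂ h₁ h₂

/-- The vector field on `ℝ` that agrees with `g` on `[a,b]`. -/
noncomputable def extend (hab : a ≤ b) (g : RHS a b d) (t : ℝ) (y : Vec d) : Vec d :=
  g (Set.projIcc a b hab t, y)

theorem extend_of_mem (hab : a ≤ b) (g : RHS a b d) {t : ℝ} (ht : t ∈ Set.Icc a b) (y : Vec d) :
    extend hab g t y = g (⟨t, ht⟩, y) := by
  rw [extend, Set.projIcc_of_mem hab ht]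

theorem InClass.lipschitzOnWith_extend (hg : InClass a b d α 1 K H L R ξ g) (hab : a ≤ b)
    (hα : 0 < α) (hL : 0 < L) (t : ℝ) :
    LipschitzOnWith L.toNNReal (extend hab g t) (Metric.closedBall 0 R) :=
  LipschitzOnWith.of_dist_le_mul fun x hx y hy => by
    rw [dist_eq_norm, dist_eq_norm, Real.coe_toNNReal _ hL.le]
    exact hg.norm_sub_le hα _ (by simpa using hx) (by simpa using hy)

theorem IsSolution.exists_extend {z : Set.Icc a b → Vec d} (hz : IsSolution ξ g z) (hab : a ≤ b) :
    ∃ Z : ℝ → Vec d, (∀ t : Set.Icc a b, Z t = z t) ∧ Z a = ξ ∧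
      ∀ t ∈ Set.Icc a b, HasDerivWithinAt Z (extend hab g t (Z t)) (Set.Icc a b) t := by
  obtain ⟨Z, hZz, hZa, hZ⟩ := hz
  refine ⟨Z, hZz, hZa, fun t ht => ?_⟩
  rw [extend_of_mem hab g ht, hZz ⟨t, ht⟩]
  exact hZ ⟨t, ht⟩

theorem InClass.norm_trajectory_le (hg : InClass a b d α β K H L R ξ g) (hab : a ≤ b) (hK : 0 < K)
    (hR : radius a b K ≤ R) {Z : ℝ → Vec d} (hZa : Z a = ξ)
    (hZ : ∀ t ∈ Set.Icc a b, HasDerivWithinAt Z (extend hab g t (Z t)) (Set.Icc a b) t)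
    {t : ℝ} (ht : t ∈ Set.Icc a b) : ‖Z t‖ ≤ R :=
  (norm_le_of_linear_growth hK hZ (hZa ▸ hg.norm_init_le)
    (fun _ _ => hg.linear_growth _ _) ht).trans ((exp_le_radius hK.le).trans hR)

theorem IsSolution.unique {z w : Set.Icc a b → Vec d} (hab : a ≤ b) (hz : IsSolution ξ g z)
    (hw : IsSolution ξ g w) (hα : 0 < α) (hK : 0 < K) (hL : 0 < L) (hR : radius a b K ≤ R)
    (hg : InClass a b d α 1 K H L R ξ g) : z = w := by
  obtain ⟨Z, hZz, hZa, hZ⟩ := hz.exists_extend hab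
  obtain ⟨W, hWw, hWa, hW⟩ := hw.exists_extend hab
  have key : Set.EqOn Z W (Set.Icc a b) := by
    refine ODE_solution_unique_of_mem_Icc_right (v := extend hab g)
      (s := fun _ => Metric.closedBall 0 R) (fun t _ => hg.lipschitzOnWith_extend hab hα hL t)
      (fun t ht => (hZ t ht).continuousWithinAt)
      (fun t ht => hasDerivWithinAt_Ici_of_Icc (hZ t ⟨ht.1, ht.2.le⟩) ht) (fun t ht => ?_)
      (fun t ht => (hW t ht).continuousWithinAt)
      (fun t ht => hasDerivWithinAt_Ici_of_Icc (hW t ⟨ht.1, ht.2.le⟩) ht) (fun t ht => ?_)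
      (hZa.trans hWa.symm)
    · rw [mem_closedBall_zero_iff]
      exact hg.norm_trajectory_le hab hK hR hZa hZ ⟨ht.1, ht.2.le⟩
    · rw [mem_closedBall_zero_iff]
      exact hg.norm_trajectory_le hab hK hR hWa hW ⟨ht.1, ht.2.le⟩
  funext t
  rw [← hZz, ← hWw, key t.2]

/-- Composed with the retraction, the field is bounded and globally Lipschitz in `y`, so
Picard–Lindelöf reaches all of `[a,b]` at once. The retraction does not increase norms, so linear
growth survives; the trajectory therefore stays in the ball, where the retraction is the identity.
-/
theorem InClass.exists_isSolution (hab : a ≤ b) (hα : 0 < α) (hK : 0 < K) (hL : 0 < L)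
    (hR : radius a b K ≤ R) (hg : InClass a b d α 1 K H L R ξ g) : ∃ z, IsSolution ξ g z := by
  have hR0 : 0 < R := by linarith [add_one_le_radius hab hK.le]
  have hR' := (exp_le_radius hK.le).trans hR
  set G : ℝ → Vec d → Vec d := fun t y => extend hab g t (radialProj R y) with hG
  set M : ℝ := K * (1 + R) with hM
  have hM0 : 0 ≤ M := by positivity
  have hPL : IsPicardLindelof G (tmin := a) (tmax := b) ⟨a, le_rfl, hab⟩ ξ
      (M * (b - a)).toNNReal 0 M.toNNReal (L * 2).toNNReal := by
    refine ⟨fun t _ => LipschitzOnWith.of_dist_le_mul fun x _ y _ => ?_, fun x _ => ?_,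
      fun t _ x _ => ?_, ?_⟩
    · rw [dist_eq_norm, dist_eq_norm, Real.coe_toNNReal _ (by positivity)]
      refine (hg.norm_sub_le hα _ (norm_radialProj_le_radius hR0 x)
        (norm_radialProj_le_radius hR0 y)).trans ?_
      rw [mul_assoc]
      exact mul_le_mul_of_nonneg_left (norm_radialProj_sub_le hR0 x y) hL.le
    · exact (hg.continuous.comp ((continuous_projIcc).prodMk continuous_const)).continuousOn
    · rw [Real.coe_toNNReal _ hM0]
      refine (hg.linear_growth _ _).trans ?_
      rw [hM]
      gcongr
      exact norm_radialProj_le_radius hR0 x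
    · rw [Real.coe_toNNReal _ hM0, Real.coe_toNNReal _ (mul_nonneg hM0 (sub_nonneg.2 hab))]
      simp [hab]
  obtain ⟨Z, hZa, hZ⟩ := hPL.exists_eq_forall_mem_Icc_hasDerivWithinAt₀
  have hZn : ∀ t ∈ Set.Icc a b, ‖Z t‖ ≤ R := fun t ht =>
    (norm_le_of_linear_growth hK hZ (hZa ▸ hg.norm_init_le) (fun s _ =>
      (hg.linear_growth _ _).trans (by gcongr; exact norm_radialProj_le_norm hR0 _)) ht).trans hR'
  refine ⟨fun t => Z t, Z, fun _ => rfl, hZa, fun t => ?_⟩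
  have := hZ t t.2
  simp only [hG] at this
  rwa [extend_of_mem hab g t.2, radialProj_of_norm_le hR0 (hZn t t.2)] at this

theorem InClass.isSolution_solution (hab : a ≤ b) (hα : 0 < α) (hK : 0 < K) (hL : 0 < L)
    (hR : radius a b K ≤ R) (hg : InClass a b d α 1 K H L R ξ g) :
    IsSolution ξ g (solution ξ g) := by
  have h := hg.exists_isSolution hab hα hK hL hR
  rw [solution, dif_pos h]
  exact Classical.choose_spec h

theorem InClass.existsUnique_isSolution (hab : a ≤ b) (hα : 0 < α) (hK : 0 < K) (hL : 0 < L)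
    (hR : radius a b K ≤ R) (hg : InClass a b d α 1 K H L R ξ g) : ∃! z, IsSolution ξ g z :=
  ⟨solution ξ g, hg.isSolution_solution hab hα hK hL hR,
    fun _ hw => hw.unique hab (hg.isSolution_solution hab hα hK hL hR) hα hK hL hR hg⟩

end Solution

/-! ### The Euler method as an adaptive algorithm. -/

section EulerAlgorithm

theorem cellIndex_lt {n : ℕ} (hn : 0 < n) (t : ℝ) : cellIndex a b n t < n :=
  (min_le_right _ _).trans_lt (Nat.sub_lt hn one_pos)

/-- The Euler method as an adaptive algorithm with `n` evaluations. -/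
noncomputable def eulerAlgorithm (hab : a ≤ b) (d : ℕ) {n : ℕ} (hn : 0 < n) : Algorithm a b d where
  card := n
  point j v x := (gridPoint hab n j, x + ((b - a) / n) • ∑ i, v i)
  out v x t :=
    x + ((b - a) / n) •
        ∑ i : Fin (cellIndex a b n t), v (Fin.castLE (cellIndex_lt hn t).le i) +
      ((t : ℝ) - gridPoint hab n (cellIndex a b n t)) • v ⟨cellIndex a b n t, cellIndex_lt hn t⟩
  out_bounded v x := by
    have hv : ∀ i, ‖v i‖ ≤ ∑ i, ‖v i‖ := fun i =>
      Finset.single_le_sum (f := fun i => ‖v i‖) (fun _ _ => norm_nonneg _) (Finset.mem_univ i)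
    refine ⟨‖x‖ + ‖(b - a) / n‖ * (n * ∑ i, ‖v i‖) + (b - a) * ∑ i, ‖v i‖, fun t => ?_⟩
    refine (norm_add_le _ _).trans (add_le_add ((norm_add_le _ _).trans ?_) ?_)
    · gcongr
      rw [norm_smul]
      gcongr
      refine (norm_sum_le _ _).trans ((Finset.sum_le_sum fun i _ => hv _).trans ?_)
      rw [Finset.sum_const, Finset.card_univ, Fintype.card_fin, nsmul_eq_mul]
      gcongr
      exact (cellIndex_lt hn t).le
    · rw [norm_smul]
      have h1 := t.2
      have h2 := (gridPoint hab n (cellIndex a b n t)).2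
      gcongr
      · rw [Real.norm_eq_abs, abs_le]
        constructor <;> linarith [h1.1, h1.2, h2.1, h2.2]
      · exact hv _

/-- An algorithm sees only observed values and the initial datum; this recovers the iterates from
them. -/
theorem eulerIterate_eq_add_sum (hab : a ≤ b) (n : ℕ) (x : Vec d) (g : RHS a b d) (k : ℕ) :
    eulerIterate hab n x g k = x + ((b - a) / n) •
      ∑ i : Fin k, g (gridPoint hab n i, eulerIterate hab n x g i) := by
  induction k with
  | zero => simp [eulerIterate]
  | succ k ih =>
    rw [eulerIterate, Fin.sum_univ_castSucc, smul_add, ← add_assoc]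
    simp only [Fin.val_castSucc, Fin.val_last]
    rw [← ih]

theorem observed_eulerAlgorithm (hab : a ≤ b) {n : ℕ} (hn : 0 < n) (x : Vec d) (g : RHS a b d)
    (j : ℕ) : (eulerAlgorithm hab d hn).observed x g j =
      fun i : Fin j => g (gridPoint hab n i, eulerIterate hab n x g i) := by
  induction j with
  | zero => exact funext fun i => i.elim0
  | succ j ih =>
    rw [Algorithm.observed, ih]
    funext i
    refine Fin.lastCases ?_ (fun i => ?_) i
    · rw [Fin.snoc_last, Fin.val_last]
      simp only [eulerAlgorithm]
      rw [← eulerIterate_eq_add_sum]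
    · rw [Fin.snoc_castSucc, Fin.val_castSucc]

theorem euler_mem_methods (hab : a ≤ b) {n : ℕ} (hn : 0 < n) : euler hab d n ∈ methods a b d n := by
  refine ⟨eulerAlgorithm hab d hn, le_rfl, ?_⟩
  funext x g t
  rw [Algorithm.run, observed_eulerAlgorithm]
  simp only [eulerAlgorithm, euler, Fin.val_castLE]
  rw [← eulerIterate_eq_add_sum]

end EulerAlgorithm

/-! ### The grid and its cells. -/

section Grid

variable {n : ℕ}

theorem coe_gridPoint (hab : a ≤ b) {k : ℕ} (hk : k ≤ n) :
    (gridPoint hab n k : ℝ) = a + k * ((b - a) / n) := by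
  have h0 : 0 ≤ (b - a) / n := div_nonneg (sub_nonneg.2 hab) n.cast_nonneg
  have hmem : a + k * ((b - a) / n) ∈ Set.Icc a b := by
    refine ⟨by have : 0 ≤ k * ((b - a) / n) := by positivity
               linarith, ?_⟩
    have h1 : k * ((b - a) / n) ≤ n * ((b - a) / n) := by gcongr
    rcases n.eq_zero_or_pos with rfl | hn
    · simpa using hab
    · have : n * ((b - a) / n) = b - a := by field_simp
      linarith
  rw [gridPoint, Set.projIcc_of_mem hab hmem]

theorem gridPoint_cellIndex_le (hab : a < b) (hn : 0 < n) (t : Set.Icc a b) :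
    (gridPoint hab.le n (cellIndex a b n t) : ℝ) ≤ t := by
  have hh : 0 < (b - a) / n := div_pos (sub_pos.2 hab) (Nat.cast_pos.2 hn)
  rw [coe_gridPoint hab.le (cellIndex_lt hn t).le]
  have h1 : (cellIndex a b n t : ℝ) ≤ (t - a) / ((b - a) / n) :=
    (Nat.cast_le.2 (min_le_left _ _)).trans
      (Nat.floor_le (div_nonneg (sub_nonneg.2 t.2.1) hh.le))
  rw [le_div_iff₀ hh] at h1
  linarith

theorem sub_gridPoint_cellIndex_le (hab : a < b) (hn : 0 < n) (t : Set.Icc a b) :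
    t - (gridPoint hab.le n (cellIndex a b n t) : ℝ) ≤ (b - a) / n := by
  have hh : 0 < (b - a) / n := div_pos (sub_pos.2 hab) (Nat.cast_pos.2 hn)
  have hn' : (n : ℝ) * ((b - a) / n) = b - a := by field_simp
  rw [coe_gridPoint hab.le (cellIndex_lt hn t).le]
  rcases le_total ⌊((t : ℝ) - a) / ((b - a) / n)⌋₊ (n - 1) with h | h
  · rw [cellIndex, min_eq_left h]
    have := (Nat.lt_floor_add_one (((t : ℝ) - a) / ((b - a) / n))).le
    rw [div_le_iff₀ hh] at this
    linarith
  -- The last cell, including `t = b`, where the floor is `n` and the cap `n - 1` matters.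
  · rw [cellIndex, min_eq_right h, Nat.cast_pred hn]
    linarith [t.2.2]

end Grid

/-! ### Error of the Euler method. -/

section EulerError

variable {α β K H L R : ℝ} {ξ : Vec d} {g : RHS a b d}

/-- Error propagation along one Euler step. -/
theorem norm_trajectory_sub_affine_le (hab : a ≤ b) (hg : InClass a b d α 1 K H L R ξ g)
    (hα : 0 < α) (hL : 0 < L) {Z : ℝ → Vec d} (hZR : ∀ t ∈ Set.Icc a b, ‖Z t‖ ≤ R)
    (hZ : ∀ t ∈ Set.Icc a b, HasDerivWithinAt Z (extend hab g t (Z t)) (Set.Icc a b) t)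
    {τ s ε : ℝ} {y w : Vec d} (hτ : a ≤ τ) (hs : s ≤ b)
    (hball : ∀ t ∈ Set.Icc τ s, ‖y + (t - τ) • w‖ ≤ R)
    (hε : ∀ t ∈ Set.Icc τ s, ‖w - extend hab g t (y + (t - τ) • w)‖ ≤ ε)
    {t : ℝ} (ht : t ∈ Set.Icc τ s) :
    ‖Z t - (y + (t - τ) • w)‖ + ε / L ≤ (‖Z τ - y‖ + ε / L) * Real.exp (L * (t - τ)) := by
  have hsub : Set.Icc τ s ⊆ Set.Icc a b := Set.Icc_subset_Icc hτ hs
  have hP : ∀ t, HasDerivAt (fun t => y + (t - τ) • w) w t := fun t => by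
    simpa using (((hasDerivAt_id t).sub_const τ).smul_const w).const_add y
  have := dist_le_of_approx_trajectories_ODE_of_mem (v := extend hab g)
    (s := fun _ => Metric.closedBall 0 R) (K := L.toNNReal) (f := Z)
    (g := fun t => y + (t - τ) • w) (f' := fun t => extend hab g t (Z t)) (g' := fun _ => w)
    (a := τ) (b := s) (εf := 0) (εg := ε) (δ := ‖Z τ - y‖)
    (fun t _ => hg.lipschitzOnWith_extend hab hα hL t)
    (fun t ht => ((hZ t (hsub ht)).continuousWithinAt).mono hsub)
    (fun t ht => hasDerivWithinAt_Ici_of_Icc (v := s)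
      ((hZ t (hsub ⟨ht.1, ht.2.le⟩)).mono hsub) ht)
    (fun t _ => by simp)
    (fun t ht => mem_closedBall_zero_iff.2 (hZR t (hsub ⟨ht.1, ht.2.le⟩)))
    (fun t _ => (hP t).continuousAt.continuousWithinAt)
    (fun t _ => (hP t).hasDerivWithinAt)
    (fun t ht => by rw [dist_eq_norm]; exact hε t ⟨ht.1, ht.2.le⟩)
    (fun t ht => mem_closedBall_zero_iff.2 (hball t ⟨ht.1, ht.2.le⟩))
    (by simp [dist_eq_norm]) t ht
  -- Moving `-ε / L` to the left makes Gronwall's bound purely multiplicative, so that steps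
  -- compose.
  rw [Real.coe_toNNReal _ hL.le, gronwallBound_of_K_ne_0 hL.ne', dist_eq_norm, zero_add] at this
  linarith

theorem norm_noisy_le (hg : InClass a b d α β K H L R ξ g) {η : RHS a b d} {δ : ℝ}
    (hη : η ∈ corruptions a b d δ) (t : Set.Icc a b) (y : Vec d) :
    ‖(g + η) (t, y)‖ ≤ (K + δ) * (1 + ‖y‖) := by
  rw [Pi.add_apply]
  linarith [norm_add_le (g (t, y)) (η (t, y)), hg.linear_growth t y, hη.2 t y]

/-- In terms of `1 + ‖y‖`, linear growth is multiplication by a factor per step. -/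
theorem one_add_norm_affine_le {y w : Vec d} {c s h : ℝ} (hw : ‖w‖ ≤ c * (1 + ‖y‖)) (hs : 0 ≤ s)
    (hsh : s ≤ h) : 1 + ‖y + s • w‖ ≤ (1 + ‖y‖) * (1 + c * h) := by
  have h1 : ‖s • w‖ ≤ h * (c * (1 + ‖y‖)) := by
    rw [norm_smul, Real.norm_of_nonneg hs]
    exact mul_le_mul hsh hw (norm_nonneg _) (hs.trans hsh)
  linarith [norm_add_le y (s • w)]

theorem one_add_norm_eulerIterate_le (hab : a ≤ b) {x : Vec d} {f : RHS a b d} {c : ℝ}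
    (hc : 0 ≤ c) (hf : ∀ t y, ‖f (t, y)‖ ≤ c * (1 + ‖y‖)) (n k : ℕ) :
    1 + ‖eulerIterate hab n x f k‖ ≤ (1 + ‖x‖) * (1 + c * ((b - a) / n)) ^ k := by
  have hh : 0 ≤ (b - a) / n := div_nonneg (sub_nonneg.2 hab) n.cast_nonneg
  induction k with
  | zero => simp [eulerIterate]
  | succ k ih =>
    rw [eulerIterate, pow_succ, ← mul_assoc]
    refine (one_add_norm_affine_le (hf _ _) hh le_rfl).trans ?_
    gcongr

/-- The noise costs `e^δ` in the initial value and `e^{δ(b-a)}` in the growth, together at most the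
factor `2` reserved in `radius`. -/
theorem growth_factor_le (hab : a ≤ b) (hK : 0 ≤ K) (hR : radius a b K ≤ R) {δ : ℝ} (hδ : 0 ≤ δ)
    (hδ2 : Real.exp (δ * (b - a + 1)) ≤ 2) {x : Vec d} (hx : ‖x‖ ≤ K + δ) {n k : ℕ} (hn : 0 < n)
    (hk : k ≤ n) : (1 + ‖x‖) * (1 + (K + δ) * ((b - a) / n)) ^ k ≤ R := by
  have hh : 0 ≤ (b - a) / n := div_nonneg (sub_nonneg.2 hab) n.cast_nonneg
  have h1 : (1 + (K + δ) * ((b - a) / n)) ^ k ≤ Real.exp ((K + δ) * (b - a)) := by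
    calc (1 + (K + δ) * ((b - a) / n)) ^ k ≤ (1 + (K + δ) * ((b - a) / n)) ^ n := by
          refine pow_le_pow_right₀ ?_ hk
          have : 0 ≤ (K + δ) * ((b - a) / n) := by positivity
          linarith
      _ ≤ Real.exp ((K + δ) * ((b - a) / n)) ^ n := by
          gcongr
          linarith [Real.add_one_le_exp ((K + δ) * ((b - a) / n))]
      _ = Real.exp ((K + δ) * (b - a)) := by
          rw [← Real.exp_nat_mul]
          congr 1
          field_simp
  have h2 : 1 + ‖x‖ ≤ (1 + K) * Real.exp δ := by
    nlinarith [Real.add_one_le_exp δ, mul_nonneg hK hδ]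
  calc (1 + ‖x‖) * (1 + (K + δ) * ((b - a) / n)) ^ k
      ≤ ((1 + K) * Real.exp δ) * Real.exp ((K + δ) * (b - a)) := by gcongr
    _ = Real.exp (δ * (b - a + 1)) * (Real.exp (K * (b - a)) * (1 + K)) := by
        rw [show (K + δ) * (b - a) = K * (b - a) + δ * (b - a) by ring,
          show δ * (b - a + 1) = δ * (b - a) + δ by ring, Real.exp_add, Real.exp_add]
        ring
    _ ≤ 2 * (Real.exp (K * (b - a)) * (1 + K)) := by gcongr
    _ ≤ R := (two_mul_exp_le_radius hK).trans hR

theorem norm_euler_sub_solution_le (hab : a < b) (hα : 0 < α) (hK : 0 < K) (hL : 0 < L)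
    (hR : radius a b K ≤ R) (hg : InClass a b d α 1 K H L R ξ g) {δ : ℝ} (hδ : 0 ≤ δ)
    (hδ2 : Real.exp (δ * (b - a + 1)) ≤ 2) {x : Vec d} (hx : ‖x - ξ‖ ≤ δ) {η : RHS a b d}
    (hη : η ∈ corruptions a b d δ) {n : ℕ} (hn : 0 < n) (t : Set.Icc a b) :
    ‖solution ξ g t - euler hab.le d n x (g + η) t‖ ≤
      (δ + (δ * R / L + ((b - a) / n) ^ α + (K + δ) * R * ((b - a) / n))) *
        Real.exp (L * (b - a)) := by
  have hR0 : 0 < R := by linarith [add_one_le_radius hab.le hK.le]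
  have hh : 0 < (b - a) / n := div_pos (sub_pos.2 hab) (Nat.cast_pos.2 hn)
  have hx' : ‖x‖ ≤ K + δ := by
    have := norm_add_le (x - ξ) ξ
    rw [sub_add_cancel] at this
    linarith [hg.norm_init_le]
  obtain ⟨Z, hZz, hZa, hZ⟩ := (hg.isSolution_solution hab.le hα hK hL hR).exists_extend hab.le
  have hZR : ∀ t ∈ Set.Icc a b, ‖Z t‖ ≤ R := fun t ht =>
    hg.norm_trajectory_le hab.le hK hR hZa hZ ht
  set h : ℝ := (b - a) / n with hh_def
  set y : ℕ → Vec d := eulerIterate hab.le n x (g + η) with hy_def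
  set w : ℕ → Vec d := fun k => (g + η) (gridPoint hab.le n k, y k) with hw_def
  -- Defect of the polygon: noise at a grid point, Hölder variation in time, Lipschitz variation
  -- over a displacement of at most `(K + δ) R h`.
  set ε : ℝ := δ * R + L * (h ^ α + (K + δ) * R * h) with hε_def
  have hεL : ε / L = δ * R / L + h ^ α + (K + δ) * R * h := by
    rw [hε_def]
    field_simp
    ring
  have hε0 : 0 ≤ ε / L := by
    rw [hεL]
    positivity
  have hyR : ∀ k ≤ n, 1 + ‖y k‖ ≤ R := fun k hk =>
    (one_add_norm_eulerIterate_le hab.le (by positivity) (norm_noisy_le hg hη) n k).trans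
      (growth_factor_le hab.le hK.le hR hδ hδ2 hx' hn hk)
  have hw : ∀ k, ‖w k‖ ≤ (K + δ) * (1 + ‖y k‖) := fun k => norm_noisy_le hg hη _ _
  have step : ∀ k < n, ∀ t ∈ Set.Icc (gridPoint hab.le n k : ℝ) (gridPoint hab.le n (k + 1)),
      ‖Z t - (y k + (t - gridPoint hab.le n k) • w k)‖ + ε / L ≤
        (‖Z (gridPoint hab.le n k) - y k‖ + ε / L) *
          Real.exp (L * (t - gridPoint hab.le n k)) := by
    intro k hk t ht
    have hlen : ∀ t ∈ Set.Icc (gridPoint hab.le n k : ℝ) (gridPoint hab.le n (k + 1)),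
        t - gridPoint hab.le n k ≤ h := by
      intro t ht
      have := ht.2
      rw [coe_gridPoint hab.le hk] at this
      rw [coe_gridPoint hab.le hk.le]
      push_cast at this
      linarith
    have hball : ∀ t ∈ Set.Icc (gridPoint hab.le n k : ℝ) (gridPoint hab.le n (k + 1)),
        ‖y k + (t - gridPoint hab.le n k) • w k‖ ≤ R := by
      intro t ht
      have h1 := one_add_norm_affine_le (hw k) (sub_nonneg.2 ht.1) (hlen t ht)
      -- The power `k + 1 ≤ n` bounds the whole segment, not just its left end.
      have h2 := growth_factor_le hab.le hK.le hR hδ hδ2 hx' hn (Nat.succ_le_of_lt hk)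
      rw [pow_succ, ← mul_assoc] at h2
      have h3 := one_add_norm_eulerIterate_le hab.le (x := x) (by positivity : 0 ≤ K + δ)
        (norm_noisy_le hg hη) n k
      have h4 : 0 ≤ 1 + (K + δ) * h := by positivity
      have h5 := mul_le_mul_of_nonneg_right h3 h4
      linarith
    refine norm_trajectory_sub_affine_le hab.le hg hα hL hZR hZ (gridPoint hab.le n k).2.1
      (gridPoint hab.le n (k + 1)).2.2 hball (fun t ht => ?_) ht
    have htI : t ∈ Set.Icc a b :=
      ⟨(gridPoint hab.le n k).2.1.trans ht.1, ht.2.trans (gridPoint hab.le n (k + 1)).2.2⟩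
    set P := y k + (t - gridPoint hab.le n k) • w k with hP
    have hPy : ‖y k - P‖ ≤ (K + δ) * R * h := by
      rw [hP, sub_add_cancel_left, norm_neg, norm_smul, Real.norm_of_nonneg (sub_nonneg.2 ht.1),
        mul_comm]
      refine mul_le_mul ((hw k).trans ?_) (hlen t ht) (sub_nonneg.2 ht.1) (by positivity)
      gcongr
      exact hyR k hk.le
    have e : w k - extend hab.le g t P =
        (g (gridPoint hab.le n k, y k) - g (⟨t, htI⟩, P)) + η (gridPoint hab.le n k, y k) := by
      rw [extend_of_mem hab.le g htI]
      simp only [hw_def, Pi.add_apply]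
      abel
    have h1 := hg.holder (gridPoint hab.le n k) ⟨t, htI⟩ (y k) P
      (by linarith [hyR k hk.le]) (hball t ht)
    have h2 : |(gridPoint hab.le n k : ℝ) - t| ^ α ≤ h ^ α := by
      refine Real.rpow_le_rpow (abs_nonneg _) ?_ hα.le
      rw [abs_sub_comm, abs_of_nonneg (sub_nonneg.2 ht.1)]
      exact hlen t ht
    have h3 : ‖η (gridPoint hab.le n k, y k)‖ ≤ δ * R :=
      (hη.2 _ _).trans (by gcongr; exact hyR k hk.le)
    rw [Real.rpow_one] at h1
    have h4 : L * (|(gridPoint hab.le n k : ℝ) - t| ^ α + ‖y k - P‖) ≤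
        L * (h ^ α + (K + δ) * R * h) := by gcongr
    rw [e]
    linarith [norm_add_le (g (gridPoint hab.le n k, y k) - g (⟨t, htI⟩, P))
      (η (gridPoint hab.le n k, y k))]
  -- The exponential factors of the steps multiply to `e^{L(t_k - a)}`, so no factor `n`
  -- accumulates.
  have grid : ∀ k ≤ n, ‖Z (gridPoint hab.le n k) - y k‖ + ε / L ≤
      (δ + ε / L) * Real.exp (L * (gridPoint hab.le n k - a)) := by
    intro k
    induction k with
    | zero =>
      intro _
      rw [coe_gridPoint hab.le n.zero_le]
      simp [hZa, hy_def, eulerIterate, norm_sub_rev ξ x, hx]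
    | succ k ih =>
      intro hk
      have hlen : (gridPoint hab.le n (k + 1) : ℝ) - gridPoint hab.le n k = h := by
        rw [coe_gridPoint hab.le hk, coe_gridPoint hab.le (Nat.le_of_succ_le hk)]
        push_cast
        ring
      have h1 := step k hk (gridPoint hab.le n (k + 1)) ⟨by linarith, le_rfl⟩
      have h2 : y k + ((gridPoint hab.le n (k + 1) : ℝ) - gridPoint hab.le n k) • w k =
          y (k + 1) := by
        rw [hlen]
        rfl
      rw [h2] at h1
      refine h1.trans ((mul_le_mul_of_nonneg_right (ih (Nat.le_of_succ_le hk))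
        (Real.exp_nonneg _)).trans_eq ?_)
      rw [mul_assoc, ← Real.exp_add]
      congr 2
      ring
  set k := cellIndex a b n t with hk_def
  have hk : k < n := cellIndex_lt hn t
  have ht1 := gridPoint_cellIndex_le hab hn t
  have ht2 : (t : ℝ) ≤ gridPoint hab.le n (k + 1) := by
    have := sub_gridPoint_cellIndex_le hab hn t
    rw [coe_gridPoint hab.le (cellIndex_lt hn t).le] at this
    rw [coe_gridPoint hab.le hk]
    push_cast
    linarith
  have h1 := step k hk t ⟨ht1, ht2⟩
  have h2 := grid k hk.le
  have h3 : euler hab.le d n x (g + η) t = y k + ((t : ℝ) - gridPoint hab.le n k) • w k := rfl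
  rw [← hZz, h3, ← hεL]
  have h4 := mul_le_mul_of_nonneg_right h2 (Real.exp_nonneg (L * (t - gridPoint hab.le n k)))
  rw [mul_assoc, ← Real.exp_add] at h4
  have h5 : (δ + ε / L) * Real.exp (L * (gridPoint hab.le n k - a) +
      L * (t - gridPoint hab.le n k)) ≤ (δ + ε / L) * Real.exp (L * (b - a)) := by
    gcongr
    nlinarith [t.2.2]
  linarith

theorem worstCaseError_euler_le (hab : a < b) (hα : 0 < α) (hα1 : α ≤ 1) (hK : 0 < K) (hL : 0 < L)
    (hR : radius a b K ≤ R) {δ : ℝ} (hδ : 0 ≤ δ) (hδ1 : δ ≤ 1)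
    (hδ2 : Real.exp (δ * (b - a + 1)) ≤ 2) {n : ℕ} (hn : 0 < n) :
    worstCaseError (euler hab.le d n) (problemClass a b d α 1 K H L R) δ ≤
      ENNReal.ofReal ((1 + R / L + (b - a) ^ α + (K + 1) * R * (b - a)) *
        Real.exp (L * (b - a)) * ((n : ℝ) ^ (-α) + δ)) := by
  have hR0 : 0 < R := by linarith [add_one_le_radius hab.le hK.le]
  have hT : 0 < b - a := sub_pos.2 hab
  have hn1 : (1 : ℝ) ≤ n := Nat.one_le_cast.2 hn
  have hN : 0 ≤ (n : ℝ) ^ (-α) := by positivity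
  refine iSup₂_le fun p hp => iSup₂_le fun q hq => iSup_le fun t => ?_
  obtain ⟨hx, η, hη, hq2⟩ := hq
  rw [← ofReal_norm, hq2]
  refine ENNReal.ofReal_le_ofReal
    ((norm_euler_sub_solution_le hab hα hK hL hR hp hδ hδ2 hx hη hn t).trans ?_)
  rw [mul_right_comm _ (Real.exp _)]
  refine mul_le_mul_of_nonneg_right ?_ (Real.exp_nonneg _)
  have h1 : ((b - a) / n) ^ α = (b - a) ^ α * (n : ℝ) ^ (-α) := by
    rw [Real.div_rpow hT.le n.cast_nonneg, Real.rpow_neg n.cast_nonneg, div_eq_mul_inv]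
  -- Here `α ≤ 1` makes the first-order term no worse than `n ^ (-α)`.
  have h2 : (b - a) / n ≤ (b - a) * (n : ℝ) ^ (-α) := by
    rw [div_eq_mul_inv, ← Real.rpow_neg_one]
    gcongr
  have h3 : (K + δ) * R * ((b - a) / n) ≤ (K + 1) * R * ((b - a) * (n : ℝ) ^ (-α)) := by
    gcongr
  have h4 : 0 ≤ (1 + R / L) * (n : ℝ) ^ (-α) := by positivity
  have h5 : 0 ≤ ((b - a) ^ α + (K + 1) * R * (b - a)) * δ := by positivity
  rw [h1]
  have h6 : δ * R / L = R / L * δ := by ring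
  rw [h6]
  nlinarith

end EulerError

/-! ### Lower bounds from indistinguishable problems. -/

section LowerBound

variable {α β K H L R : ℝ}

theorem self_mem_noisyData {ξ : Vec d} {g : RHS a b d} {δ : ℝ} (hδ : 0 ≤ δ) {x : Vec d}
    (hx : ‖x - ξ‖ ≤ δ) : (x, g) ∈ noisyData ξ g δ :=
  ⟨hx, 0, ⟨measurable_const, fun t y => by simpa using by positivity⟩, (add_zero g).symm⟩

/-- Two problems for which a method produces the same output are hard for that method. -/
theorem le_worstCaseError {M : Method a b d} {G : Set (Vec d × RHS a b d)} {δ : ℝ}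
    {p p' q q' : Vec d × RHS a b d} (hp : p ∈ G) (hp' : p' ∈ G) (hq : q ∈ noisyData p.1 p.2 δ)
    (hq' : q' ∈ noisyData p'.1 p'.2 δ) (hM : M q.1 q.2 = M q'.1 q'.2) (t : Set.Icc a b) :
    ENNReal.ofReal (‖solution p.1 p.2 t - solution p'.1 p'.2 t‖ / 2) ≤
      worstCaseError M G δ := by
  have h1 : ENNReal.ofReal ‖solution p.1 p.2 t - M q.1 q.2 t‖ ≤ worstCaseError M G δ := by
    rw [ofReal_norm]
    exact le_iSup₂_of_le p hp (le_iSup₂_of_le q hq (le_iSup_of_le t le_rfl))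
  have h2 : ENNReal.ofReal ‖solution p'.1 p'.2 t - M q.1 q.2 t‖ ≤ worstCaseError M G δ := by
    rw [ofReal_norm, hM]
    exact le_iSup₂_of_le p' hp' (le_iSup₂_of_le q' hq' (le_iSup_of_le t le_rfl))
  have h3 := norm_sub_le_norm_sub_add_norm_sub (solution p.1 p.2 t) (M q.1 q.2 t)
    (solution p'.1 p'.2 t)
  rw [norm_sub_rev (M q.1 q.2 t)] at h3
  rcases le_total ‖solution p.1 p.2 t - M q.1 q.2 t‖ ‖solution p'.1 p'.2 t - M q.1 q.2 t‖ with h | h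
  · exact (ENNReal.ofReal_le_ofReal (by linarith)).trans h2
  · exact (ENNReal.ofReal_le_ofReal (by linarith)).trans h1

/-- The right-hand side `(t, y) ↦ κ y + φ(t) v`, cut off at radius `R`. -/
noncomputable def affineRHS (a b : ℝ) {d : ℕ} (κ R : ℝ) (v : Vec d) (φ : ℝ → ℝ) : RHS a b d :=
  fun p => κ • radialProj R p.2 + φ p.1 • v

theorem inClass_affineRHS (hK : 0 < K) (hR : 0 < R)
    {κ m : ℝ} (hκ : κ ≤ 0) (hκH : κ ≤ H) (hκL : -L ≤ κ) (hmK : m ≤ K)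
    (hm : -κ * R + m ≤ K * (1 + R)) {ξ v : Vec d} (hξ : ‖ξ‖ ≤ K) (hv : ‖v‖ = 1) {φ : ℝ → ℝ}
    (hφ : Continuous φ) (hφm : ∀ t ∈ Set.Icc a b, |φ t| ≤ m)
    (hφL : ∀ s ∈ Set.Icc a b, ∀ t ∈ Set.Icc a b, |φ s - φ t| ≤ L * |s - t| ^ α) :
    InClass a b d α 1 K H L R ξ (affineRHS a b κ R v φ) where
  norm_init_le := hξ
  continuous := by
    have := (continuous_radialProj (d := d) hR).comp
      (continuous_snd : Continuous fun p : Set.Icc a b × Vec d => p.2)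
    exact (this.const_smul κ).add
      ((hφ.comp (continuous_subtype_val.comp continuous_fst)).smul continuous_const)
  linear_growth t y := by
    have h1 := norm_radialProj_le_radius hR y
    have h2 := norm_radialProj_le_norm hR y
    have h0 := norm_nonneg (radialProj R y)
    set s := ‖radialProj R y‖ with hs
    -- Both sides are affine in `s ∈ [0, R]`, so the end points suffice: `hmK` at `0`, `hm` at `R`.
    have h3 : -κ * s + m ≤ K * (1 + s) := by
      have e1 : (R - s) * (K - m) + s * (K * (1 + R) - (-κ * R + m)) ≥ 0 := by
        have := mul_nonneg (sub_nonneg.2 h1) (sub_nonneg.2 hmK)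
        have := mul_nonneg h0 (sub_nonneg.2 hm)
        linarith
      have e2 : R * (K * (1 + s) - (-κ * s + m)) ≥ 0 := by linarith
      have := nonneg_of_mul_nonneg_right e2 hR
      linarith
    calc ‖affineRHS a b κ R v φ (t, y)‖
        ≤ ‖κ • radialProj R y‖ + ‖φ t • v‖ := norm_add_le _ _
      _ ≤ -κ * s + m := by
          rw [norm_smul, norm_smul, hv, mul_one, Real.norm_of_nonpos hκ]
          exact add_le_add le_rfl (hφm t t.2)
      _ ≤ K * (1 + s) := h3
      _ ≤ K * (1 + ‖y‖) := by gcongr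
  one_sided t y₁ y₂ h₁ h₂ := by
    simp only [affineRHS, radialProj_of_norm_le hR h₁, radialProj_of_norm_le hR h₂]
    rw [add_sub_add_right_eq_sub, ← smul_sub, inner_smul_right, real_inner_self_eq_norm_sq]
    gcongr
  holder t₁ t₂ y₁ y₂ h₁ h₂ := by
    simp only [affineRHS, radialProj_of_norm_le hR h₁, radialProj_of_norm_le hR h₂, Real.rpow_one]
    have e : κ • y₁ + φ t₁ • v - (κ • y₂ + φ t₂ • v) = κ • (y₁ - y₂) + (φ t₁ - φ t₂) • v := by
      module
    rw [e]
    refine (norm_add_le _ _).trans ?_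
    rw [norm_smul, norm_smul, hv, mul_one, Real.norm_of_nonpos hκ, Real.norm_eq_abs]
    have := hφL t₁ t₁.2 t₂ t₂.2
    have : -κ * ‖y₁ - y₂‖ ≤ L * ‖y₁ - y₂‖ := by
      gcongr
      linarith
    linarith

/-- Two right-hand sides that agree at the points visited for one of them yield the same
observations. -/
theorem observed_congr (A : Algorithm a b d) (x : Vec d) {g g' : RHS a b d} {m : ℕ}
    (h : ∀ j < m, g (A.point j (A.observed x g j) x) = g' (A.point j (A.observed x g j) x)) {j : ℕ}
    (hj : j ≤ m) : A.observed x g' j = A.observed x g j := by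
  induction j with
  | zero => rfl
  | succ j ih =>
    simp only [Algorithm.observed]
    rw [ih (Nat.le_of_succ_le hj), h j hj]

theorem abs_rpow_sub_rpow_le {p x y : ℝ} (hx : 0 ≤ x) (hy : 0 ≤ y) (hp : 0 ≤ p) (hp1 : p ≤ 1) :
    |x ^ p - y ^ p| ≤ |x - y| ^ p := by
  wlog hxy : y ≤ x generalizing x y
  · rw [abs_sub_comm, abs_sub_comm x]
    exact this hy hx (le_of_not_ge hxy)
  rw [abs_of_nonneg (sub_nonneg.2 (Real.rpow_le_rpow hy hxy hp)), abs_of_nonneg (sub_nonneg.2 hxy)]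
  have := Real.rpow_add_le_add_rpow (sub_nonneg.2 hxy) hy hp hp1
  rw [sub_add_cancel] at this
  linarith

/-- The distance is 1-Lipschitz and `x ^ α` is subadditive. -/
theorem abs_infDist_rpow_sub_le {S : Set ℝ} {α : ℝ} (hα : 0 ≤ α) (hα1 : α ≤ 1) (s t : ℝ) :
    |Metric.infDist s S ^ α - Metric.infDist t S ^ α| ≤ |s - t| ^ α := by
  refine (abs_rpow_sub_rpow_le Metric.infDist_nonneg Metric.infDist_nonneg hα hα1).trans ?_
  refine Real.rpow_le_rpow (abs_nonneg _) ?_ hα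
  simpa [Real.dist_eq] using (Metric.lipschitz_infDist_pt S).dist_le_mul s t

/-- The integral of a power of the distance to `m` points is at least of order `m⁻ᵅ`. -/
theorem le_integral_infDist_rpow (hab : a < b) {α : ℝ} (hα : 0 < α) {S : Finset ℝ}
    (hS : S.Nonempty) {m : ℕ} (hm : S.card ≤ m) :
    ((b - a) / (4 * m)) ^ α * ((b - a) / 2) ≤
      ∫ t in a..b, Metric.infDist t (S : Set ℝ) ^ α := by
  have hT : 0 < b - a := sub_pos.2 hab
  have hm0 : 0 < m := (Finset.card_pos.2 hS).trans_le hm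
  set r : ℝ := (b - a) / (4 * m) with hr_def
  have hr : 0 < r := by positivity
  have hcont : Continuous fun t : ℝ => Metric.infDist t (S : Set ℝ) ^ α :=
    (Metric.continuous_infDist_pt _).rpow_const fun _ => Or.inr hα.le
  -- These balls have total length at most `2 r m = (b - a) / 2`; on the remaining half of the
  -- interval the distance is at least `r`.
  set U : Set ℝ := ⋃ s ∈ S, Metric.ball s r with hU
  have hUm : MeasurableSet U := Finset.measurableSet_biUnion _ fun _ _ => measurableSet_ball
  have hUv : MeasureTheory.volume U ≤ ENNReal.ofReal ((b - a) / 2) := by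
    refine (MeasureTheory.measure_biUnion_finset_le _ _).trans ?_
    simp only [Real.volume_ball, Finset.sum_const, nsmul_eq_mul]
    rw [← ENNReal.ofReal_natCast, ← ENNReal.ofReal_mul (Nat.cast_nonneg _)]
    refine ENNReal.ofReal_le_ofReal ?_
    calc (S.card : ℝ) * (2 * r) ≤ m * (2 * r) := by gcongr
      _ = (b - a) / 2 := by rw [hr_def]; field_simp; norm_num
  have hdiff : ENNReal.ofReal ((b - a) / 2) ≤ MeasureTheory.volume (Set.Ioc a b \ U) := by
    have h1 := MeasureTheory.le_measure_sdiff (μ := MeasureTheory.volume) (s₁ := Set.Ioc a b)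
      (s₂ := U)
    rw [Real.volume_Ioc] at h1
    refine le_trans ?_ h1
    rw [ENNReal.le_sub_iff_add_le_right (ne_top_of_le_ne_top ENNReal.ofReal_ne_top hUv)]
    · refine (add_le_add le_rfl hUv).trans ?_
      rw [← ENNReal.ofReal_add (by positivity) (by positivity), add_halves]
    · exact hUv.trans (ENNReal.ofReal_le_ofReal (by linarith))
  have hDm : MeasurableSet (Set.Ioc a b \ U) := measurableSet_Ioc.diff hUm
  have hDfin : MeasureTheory.volume (Set.Ioc a b \ U) ≠ ⊤ :=
    ne_top_of_le_ne_top (by simp) (MeasureTheory.measure_mono Set.sdiff_subset)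
  rw [intervalIntegral.integral_of_le hab.le]
  have hint : MeasureTheory.IntegrableOn (fun t : ℝ => Metric.infDist t (S : Set ℝ) ^ α)
      (Set.Ioc a b) := (hcont.integrableOn_Icc).mono_set Set.Ioc_subset_Icc_self
  calc r ^ α * ((b - a) / 2)
      ≤ r ^ α * MeasureTheory.volume.real (Set.Ioc a b \ U) := by
        gcongr
        rw [MeasureTheory.measureReal_def]
        exact (ENNReal.ofReal_le_iff_le_toReal hDfin).1 hdiff
    _ ≤ ∫ t in Set.Ioc a b \ U, Metric.infDist t (S : Set ℝ) ^ α := by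
        refine MeasureTheory.setIntegral_ge_of_const_le_real hDm hDfin (fun t ht => ?_)
          (hint.mono_set Set.sdiff_subset)
        refine Real.rpow_le_rpow hr.le ?_ hα.le
        rw [Metric.le_infDist (by simpa using hS)]
        intro s hs
        by_contra hlt
        exact ht.2 (Set.mem_biUnion (Finset.mem_coe.1 hs) (Metric.mem_ball.2 (not_le.1 hlt)))
    _ ≤ ∫ t in Set.Ioc a b, Metric.infDist t (S : Set ℝ) ^ α :=
        MeasureTheory.setIntegral_mono_set hint
          (Filter.Eventually.of_forall fun t => Real.rpow_nonneg Metric.infDist_nonneg _)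
          (Filter.Eventually.of_forall Set.sdiff_subset)

/-- The solutions for the right-hand sides `κ y ± φ(t) v` are far apart at the time `b`. -/
theorem le_norm_solution_sub (hab : a < b) (hα : 0 < α) (hK : 0 < K) (hL : 0 < L)
    (hR : radius a b K ≤ R) {κ : ℝ} (hκ : κ ≤ 0) {v : Vec d} (hv : ‖v‖ = 1) {φ : ℝ → ℝ}
    (hφ : Continuous φ) (hφ0 : ∀ t, 0 ≤ φ t)
    (h₁ : InClass a b d α 1 K H L R 0 (affineRHS a b κ R v φ))
    (h₂ : InClass a b d α 1 K H L R 0 (affineRHS a b κ R v (-φ))) :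
    Real.exp (κ * (b - a)) * ∫ t in a..b, φ t ≤
      ‖solution 0 (affineRHS a b κ R v φ) ⟨b, hab.le, le_rfl⟩ -
        solution 0 (affineRHS a b κ R v (-φ)) ⟨b, hab.le, le_rfl⟩‖ / 2 := by
  have hR0 : 0 < R := by linarith [add_one_le_radius hab.le hK.le]
  obtain ⟨Z, hZz, hZa, hZ⟩ := (h₁.isSolution_solution hab.le hα hK hL hR).exists_extend hab.le
  obtain ⟨W, hWw, hWa, hW⟩ := (h₂.isSolution_solution hab.le hα hK hL hR).exists_extend hab.le
  rw [← hZz, ← hWw]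
  -- Along `v` the difference solves the scalar equation `u' = κ u + 2 φ`, `u(a) = 0`. The
  -- integrating factor `e^{-κ(t-a)}` is at least `1` because `κ ≤ 0`, so it can be dropped under
  -- the integral.
  set u : ℝ → ℝ := fun t => inner ℝ v (Z t - W t) with hu
  have hu' : ∀ t ∈ Set.Icc a b, HasDerivWithinAt u (κ * u t + 2 * φ t) (Set.Icc a b) t := by
    intro t ht
    have h := (hasDerivWithinAt_const t (Set.Icc a b) v).inner ℝ ((hZ t ht).sub (hW t ht))
    have e : extend hab.le (affineRHS a b κ R v φ) t (Z t) -
        extend hab.le (affineRHS a b κ R v (-φ)) t (W t) = κ • (Z t - W t) + (2 * φ t) • v := by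
      rw [extend_of_mem hab.le _ ht, extend_of_mem hab.le _ ht]
      simp only [affineRHS, Pi.neg_apply]
      rw [radialProj_of_norm_le hR0 (h₁.norm_trajectory_le hab.le hK hR hZa hZ ht),
        radialProj_of_norm_le hR0 (h₂.norm_trajectory_le hab.le hK hR hWa hW ht)]
      module
    rw [e, inner_zero_left, add_zero, inner_add_right, inner_smul_right, inner_smul_right,
      real_inner_self_eq_norm_sq, hv, one_pow, mul_one] at h
    exact h
  set m : ℝ → ℝ := fun t => Real.exp (-(κ * (t - a))) * u t with hm
  have hm' : ∀ t ∈ Set.Icc a b,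
      HasDerivWithinAt m (Real.exp (-(κ * (t - a))) * (2 * φ t)) (Set.Icc a b) t := by
    intro t ht
    have h1 : HasDerivAt (fun t => -(κ * (t - a))) (-(κ * 1)) t :=
      (((hasDerivAt_id t).sub_const a).const_mul κ).neg
    refine (h1.exp.hasDerivWithinAt.mul (hu' t ht)).congr_deriv ?_
    ring
  have key := intervalIntegral.integral_le_sub_of_hasDeriv_right_of_le (g := m)
    (φ := fun t => 2 * φ t) hab.le (fun t ht => (hm' t ht).continuousWithinAt)
    (fun t ht => (hasDerivWithinAt_Ici_of_Icc (hm' t ⟨ht.1.le, ht.2.le⟩)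
      ⟨ht.1.le, ht.2⟩).mono Set.Ioi_subset_Ici_self)
    ((hφ.const_mul 2).integrableOn_Icc) (fun t ht => by
      refine le_mul_of_one_le_left (by linarith [hφ0 t]) (Real.one_le_exp ?_)
      have := mul_nonneg (neg_nonneg.2 hκ) (sub_nonneg.2 ht.1.le)
      linarith)
  have hma : m a = 0 := by simp [hm, hu, hZa, hWa]
  have hub : u b ≤ ‖Z b - W b‖ := by
    simpa [hv] using real_inner_le_norm v (Z b - W b)
  rw [hma, sub_zero, intervalIntegral.integral_const_mul] at key
  have h1 : Real.exp (κ * (b - a)) * m b = u b := by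
    rw [hm, ← mul_assoc, ← Real.exp_add, add_neg_cancel, Real.exp_zero, one_mul]
  have h2 := mul_le_mul_of_nonneg_left key (Real.exp_nonneg (κ * (b - a)))
  rw [h1] at h2
  change _ ≤ ‖Z b - W b‖ / 2
  linarith

/-- Noise in the initial value suffices: the solutions from `±δ v` are already `2δ` apart at `t =
a`, and `δ ≤ K` keeps both problems in the class. -/
theorem le_minimalError_noise (hab : a < b) (hd : 0 < d) (hα : 0 < α) (hK : 0 < K) (hL : 0 < L)
    (hR : radius a b K ≤ R) (hHL : -L ≤ H) (hHK : -(K * (1 + R)) < H * R) {δ : ℝ} (hδ : 0 ≤ δ)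
    (hδK : δ ≤ K) (n : ℕ) :
    ENNReal.ofReal δ ≤ minimalError n (problemClass a b d α 1 K H L R) δ := by
  have hR0 : 0 < R := by linarith [add_one_le_radius hab.le hK.le]
  refine le_iInf₂ fun M _ => ?_
  set v : Vec d := EuclideanSpace.single ⟨0, hd⟩ 1 with hv_def
  have hv : ‖v‖ = 1 := by simp [hv_def]
  set g : RHS a b d := affineRHS a b (min H 0) R v 0 with hg
  have hκ : -min H 0 * R ≤ K * (1 + R) := by
    rcases min_choice H 0 with h | h <;> rw [h]
    · linarith
    · rw [neg_zero, zero_mul]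
      positivity
  have hδv : ‖δ • v‖ = δ := by rw [norm_smul, hv, mul_one, Real.norm_of_nonneg hδ]
  have hcl : ∀ ξ : Vec d, ‖ξ‖ ≤ K → InClass a b d α 1 K H L R ξ g := fun ξ hξ =>
    inClass_affineRHS (m := 0) hK hR0 (min_le_right _ _) (min_le_left _ _)
      (le_min hHL (neg_nonpos.2 hL.le)) hK.le (by linarith) hξ hv continuous_zero
      (fun _ _ => by simp) (fun _ _ _ _ => by simpa using by positivity)
  have h₁ := hcl (δ • v) (by rwa [hδv])
  have h₂ := hcl (-(δ • v)) (by rwa [norm_neg, hδv])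
  have init : ∀ ξ : Vec d, InClass a b d α 1 K H L R ξ g →
      solution ξ g ⟨a, le_rfl, hab.le⟩ = ξ := fun ξ hξ => by
    obtain ⟨Z, hZz, hZa, -⟩ := hξ.isSolution_solution hab.le hα hK hL hR
    rw [← hZz, hZa]
  have := le_worstCaseError (M := M) (G := problemClass a b d α 1 K H L R) (δ := δ)
    (p := (δ • v, g)) (p' := (-(δ • v), g)) (q := (0, g)) (q' := (0, g)) h₁ h₂
    (self_mem_noisyData hδ (by rw [zero_sub, norm_neg, hδv]))
    (self_mem_noisyData hδ (by rw [sub_neg_eq_add, zero_add, hδv])) rfl ⟨a, le_rfl, hab.le⟩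
  rw [init _ h₁, init _ h₂, sub_neg_eq_add, ← two_smul ℝ, norm_smul, hδv] at this
  simpa using this

theorem exists_le_minimalError_rpow (hab : a < b) (hd : 0 < d) (hα : 0 < α) (hα1 : α ≤ 1)
    (hK : 0 < K) (hL : 0 < L) (hR : radius a b K ≤ R) (hHL : -L ≤ H)
    (hHK : -(K * (1 + R)) < H * R) :
    ∃ c > 0, ∀ n : ℕ, 0 < n → ∀ δ : ℝ, 0 ≤ δ →
      ENNReal.ofReal (c * (n : ℝ) ^ (-α)) ≤
        minimalError n (problemClass a b d α 1 K H L R) δ := by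
  have hR0 : 0 < R := by linarith [add_one_le_radius hab.le hK.le]
  have hT : 0 < b - a := sub_pos.2 hab
  -- The one-sided condition needs `κ ≤ H`, the Lipschitz condition `-L ≤ κ`; `hHK` leaves strict
  -- room in the growth bound at `‖y‖ = R` for a perturbation of size `m`.
  set κ : ℝ := min H 0 with hκ_def
  have hκ0 : κ ≤ 0 := min_le_right _ _
  have hκ : 0 < K * (1 + R) + κ * R := by
    rcases min_choice H 0 with h | h <;> rw [hκ_def, h]
    · linarith
    · rw [zero_mul, add_zero]
      positivity
  set m : ℝ := min K (K * (1 + R) + κ * R) with hm_def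
  have hm0 : 0 < m := lt_min hK hκ
  -- `L` caps the Hölder constant of `φ`, the other term its size.
  set c : ℝ := min L (m / (b - a) ^ α) with hc_def
  have hc0 : 0 < c := lt_min hL (by positivity)
  have hcm : c * (b - a) ^ α ≤ m := by
    rw [← le_div_iff₀ (by positivity)]
    exact min_le_right _ _
  set v : Vec d := EuclideanSpace.single ⟨0, hd⟩ 1 with hv_def
  have hv : ‖v‖ = 1 := by simp [hv_def]
  refine ⟨Real.exp (κ * (b - a)) * (c * (((b - a) / 8) ^ α * ((b - a) / 2))), by positivity,
    fun n hn δ hδ => le_iInf₂ fun M hM => ?_⟩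
  obtain ⟨A, hA, rfl⟩ := hM
  set g₀ : RHS a b d := affineRHS a b κ R v 0 with hg₀
  set pt : ℕ → Set.Icc a b × Vec d := fun j => A.point j (A.observed 0 g₀ j) 0 with hpt
  -- The extra point `a` makes `S` nonempty and all distances at most `b - a`. It raises the count
  -- to `n + 1`, and `4 (n + 1) ≤ 8 n` gives the `8` in the constant.
  set S : Finset ℝ := insert a ((Finset.range A.card).image fun j => ((pt j).1 : ℝ)) with hS
  have hScard : S.card ≤ n + 1 := by
    refine (Finset.card_insert_le _ _).trans (Nat.succ_le_succ (Finset.card_image_le.trans ?_))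
    simpa using hA
  have hSne : S.Nonempty := Finset.insert_nonempty _ _
  set φ : ℝ → ℝ := fun t => c * Metric.infDist t (S : Set ℝ) ^ α with hφ_def
  have hφc : Continuous φ :=
    ((Metric.continuous_infDist_pt _).rpow_const fun _ => Or.inr hα.le).const_mul c
  have hφ0 : ∀ t, 0 ≤ φ t := fun t =>
    mul_nonneg hc0.le (Real.rpow_nonneg Metric.infDist_nonneg _)
  have hφm : ∀ t ∈ Set.Icc a b, φ t ≤ m := fun t ht => by
    refine le_trans ?_ hcm
    have h1 : Metric.infDist t (S : Set ℝ) ≤ b - a := by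
      refine (Metric.infDist_le_dist_of_mem (y := a) (by simp [hS])).trans ?_
      rw [Real.dist_eq, abs_of_nonneg (sub_nonneg.2 ht.1)]
      linarith [ht.2]
    exact mul_le_mul_of_nonneg_left
      (Real.rpow_le_rpow Metric.infDist_nonneg h1 hα.le) hc0.le
  have hφL : ∀ s t, |φ s - φ t| ≤ L * |s - t| ^ α := fun s t => by
    rw [hφ_def, ← mul_sub, abs_mul, abs_of_pos hc0]
    exact mul_le_mul (min_le_left _ _) (abs_infDist_rpow_sub_le hα.le hα1 s t) (abs_nonneg _)
      hL.le
  have hcl : ∀ ψ : ℝ → ℝ, Continuous ψ → (∀ t ∈ Set.Icc a b, |ψ t| ≤ m) →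
      (∀ s t, |ψ s - ψ t| ≤ L * |s - t| ^ α) →
      InClass a b d α 1 K H L R 0 (affineRHS a b κ R v ψ) := fun ψ h1 h2 h3 =>
    inClass_affineRHS hK hR0 hκ0 (min_le_left _ _)
      (le_min hHL (neg_nonpos.2 hL.le)) (min_le_left _ _)
      (by linarith [min_le_right K (K * (1 + R) + κ * R)]) (by simpa using hK.le) hv h1 h2
      (fun s _ t _ => h3 s t)
  have h₁ := hcl φ hφc (fun t ht => by rw [abs_of_nonneg (hφ0 t)]; exact hφm t ht) hφL
  have h₂ := hcl (-φ) hφc.neg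
    (fun t ht => by rw [Pi.neg_apply, abs_neg, abs_of_nonneg (hφ0 t)]; exact hφm t ht)
    (fun s t => by
      rw [Pi.neg_apply, Pi.neg_apply, ← neg_sub', abs_neg]
      exact hφL s t)
  have hφpt : ∀ j < A.card, φ (pt j).1 = 0 := fun j hj => by
    have : ((pt j).1 : ℝ) ∈ (S : Set ℝ) :=
      Finset.mem_coe.2 (Finset.mem_insert_of_mem
        (Finset.mem_image_of_mem (fun j => ((pt j).1 : ℝ)) (Finset.mem_range.2 hj)))
    rw [hφ_def]
    simp only [Metric.infDist_zero_of_mem this, Real.zero_rpow hα.ne', mul_zero]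
  have hrun : ∀ ψ : ℝ → ℝ, (∀ j < A.card, ψ (pt j).1 = 0) →
      A.run 0 (affineRHS a b κ R v ψ) = A.run 0 g₀ := fun ψ hψ => by
    rw [Algorithm.run, Algorithm.run, observed_congr A 0 (g := g₀) (fun j hj => ?_) le_rfl]
    change κ • radialProj R (pt j).2 + (0 : ℝ) • v =
      κ • radialProj R (pt j).2 + ψ (pt j).1 • v
    rw [hψ j hj]
  have hmain := le_worstCaseError (M := A.run) (G := problemClass a b d α 1 K H L R) (δ := δ)
    (p := (0, affineRHS a b κ R v φ)) (p' := (0, affineRHS a b κ R v (-φ)))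
    (q := (0, affineRHS a b κ R v φ)) (q' := (0, affineRHS a b κ R v (-φ))) h₁ h₂
    (self_mem_noisyData hδ (by simpa using hδ)) (self_mem_noisyData hδ (by simpa using hδ))
    ((hrun φ hφpt).trans
      (hrun (-φ) fun j hj => by rw [Pi.neg_apply, hφpt j hj, neg_zero]).symm)
    ⟨b, hab.le, le_rfl⟩
  refine le_trans (ENNReal.ofReal_le_ofReal ?_) hmain
  refine le_trans ?_ (le_norm_solution_sub hab hα hK hL hR hκ0 hv hφc hφ0 h₁ h₂)
  rw [mul_assoc]
  refine mul_le_mul_of_nonneg_left ?_ (Real.exp_nonneg _)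
  rw [hφ_def, intervalIntegral.integral_const_mul, mul_assoc]
  refine mul_le_mul_of_nonneg_left ?_ hc0.le
  refine le_trans ?_ (le_integral_infDist_rpow hab hα hSne hScard)
  rw [mul_right_comm]
  refine mul_le_mul_of_nonneg_right ?_ (by positivity)
  rw [Real.rpow_neg n.cast_nonneg, ← div_eq_mul_inv, ← Real.div_rpow (by positivity) n.cast_nonneg]
  refine Real.rpow_le_rpow (by positivity) ?_ hα.le
  rw [div_div]
  have : (1 : ℝ) ≤ n := Nat.one_le_cast.2 hn
  refine div_le_div_of_nonneg_left hT.le (by positivity) ?_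
  push_cast
  linarith

end LowerBound

end NoisyODE

theorem mainTheorem5 (a b : ℝ) (hab : a < b) (d : ℕ) (hd : 0 < d) (α K H L R : ℝ)
    (hα : 0 < α) (hα1 : α ≤ 1) (hK : 0 < K) (hL : 0 < L) (hR : radius a b K ≤ R)
    (hHL : -L ≤ H) (hHK : -(K * (1 + R)) < H * R) :
    (∀ p ∈ problemClass a b d α 1 K H L R, ∃! z, IsSolution p.1 p.2 z) ∧
    (∀ n : ℕ, 1 ≤ n → euler hab.le d n ∈ methods a b d n) ∧
    ∃ c C : ℝ, 0 < c ∧ 0 < C ∧ ∃ (n₀ : ℕ) (δ₀ : ℝ), 0 < δ₀ ∧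
      ∀ n : ℕ, n₀ ≤ n → ∀ δ : ℝ, 0 ≤ δ → δ ≤ δ₀ →
        ENNReal.ofReal (c * ((n : ℝ) ^ (-α) + δ)) ≤
          minimalError n (problemClass a b d α 1 K H L R) δ ∧
        minimalError n (problemClass a b d α 1 K H L R) δ ≤
          ENNReal.ofReal (C * ((n : ℝ) ^ (-α) + δ)) ∧
        worstCaseError (euler hab.le d n) (problemClass a b d α 1 K H L R) δ ≤
          ENNReal.ofReal (C * ((n : ℝ) ^ (-α) + δ)) := by
  have hT : 0 < b - a := sub_pos.2 hab
  have hR0 : 0 < R := by linarith [add_one_le_radius hab.le hK.le]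
  refine ⟨fun p hp => InClass.existsUnique_isSolution hab.le hα hK hL hR hp,
    fun n hn => euler_mem_methods hab.le hn, ?_⟩
  obtain ⟨c, hc, hlow⟩ := exists_le_minimalError_rpow hab hd hα hα1 hK hL hR hHL hHK
  -- The larger of the two lower bounds is at least half their sum. In `δ₀`, the `1` makes the upper
  -- constant uniform in `δ`, `K` serves the noise lower bound, and the logarithm keeps Euler
  -- polygons in the ball.
  refine ⟨min c 1 / 2, (1 + R / L + (b - a) ^ α + (K + 1) * R * (b - a)) *
    Real.exp (L * (b - a)), by positivity, by positivity, 1,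
    min (min 1 K) (Real.log 2 / (b - a + 1)),
    lt_min (lt_min one_pos hK) (div_pos (Real.log_pos one_lt_two) (by linarith)),
    fun n hn δ hδ hδ0 => ?_⟩
  have hδ1 : δ ≤ 1 := hδ0.trans ((min_le_left _ _).trans (min_le_left _ _))
  have hδK : δ ≤ K := hδ0.trans ((min_le_left _ _).trans (min_le_right _ _))
  have hδ2 : Real.exp (δ * (b - a + 1)) ≤ 2 := by
    rw [← Real.le_log_iff_exp_le two_pos, ← le_div_iff₀ (by linarith)]
    exact hδ0.trans (min_le_right _ _)
  have hup := worstCaseError_euler_le (d := d) (H := H) hab hα hα1 hK hL hR hδ hδ1 hδ2 hn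
  refine ⟨?_, (iInf₂_le _ (euler_mem_methods hab.le hn)).trans hup, hup⟩
  have h1 := hlow n hn δ hδ
  have h2 := le_minimalError_noise (H := H) hab hd hα hK hL hR hHL hHK hδ hδK n
  have hN : 0 ≤ (n : ℝ) ^ (-α) := by positivity
  have h3 : min c 1 * (n : ℝ) ^ (-α) ≤ c * (n : ℝ) ^ (-α) := by
    gcongr
    exact min_le_left _ _
  have h4 : min c 1 * δ ≤ δ := mul_le_of_le_one_left hδ (min_le_right _ _)
  rcases le_total (c * (n : ℝ) ^ (-α)) δ with h | h
  · exact (ENNReal.ofReal_le_ofReal (by linarith)).trans h2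
  · exact (ENNReal.ofReal_le_ofReal (by linarith)).trans h1
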